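/- Setting. A platform with $\kappa\ge 1$ CPUs is shared by $n$ applications. Application $i$ has constants $\beta_i>0$ and $\underline s_i>0$ and a weight $\lambda_i\in(0,1]$. Write $[x]_-=\min\{x,0\}$, $$\varphi_i(s_i,v_i)=\beta_i\frac{v_i}{s_i}-1,\qquad \Phi_i(\mathbf s,\mathbf v)=-(1-\bar v_i)\lambda_i[\varphi_i(s_i,v_i)]_-+\bar v_i\sum_{j\ne i}\lambda_j[\varphi_j(s_j,v_j)]_-,\qquad \bar v_i=v_i/\kappa .$$ The constraint sets are $\mathcal S_i=[\underline s_i,\infty)$ and $\overline{\mathcal V}_i=[0,1/\kappa]$; a state $(\mathbf s,\bar{\mathbf v})$ is feasible if moreover $\sum_i\bar v_i\le 1$. Consider the projected ODE $$(\dot s_i,\dot{\bar v}_i)=\big(\varphi_i(s_i,\kappa\bar v_i),\ \Phi_i(\mathbf s,\kappa\bar{\mathbf v})\big)+\mathbf z_i,\qquad i=1,\dots,n,$$ where $\mathbf z_i$ is the vector of minimum length that drives $(s_i,\bar v_i)$ back to $\mathcal S_i\times\overline{\mathcal V}_i$ (i.e. for which the right-hand side lies in the tangent cone of this set), and the synchronous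 recursions with constant step size $\epsilon>0$ $$s_i(t_{k+1})=\Pi_{\mathcal S_i}\big[s_i(t_k)+\epsilon\varphi_i(s_i(t_k),\kappa\bar v_i(t_k))\big],\qquad \bar v_i(t_{k+1})=\Pi_{\overline{\mathcal V}_i}\big[\bar v_i(t_k)+\epsilon\Phi_i(\mathbf s(t_k),\kappa\bar{\mathbf v}(t_k))\big].$$ A stationary point is a state at which the right-hand side of the ODE vanishes. Consider two hypotheses: (H1) $\beta_i/\underline s_i<1$ for all $i$. (H2) There are $0<\zeta\le 1/\kappa$ with $\max_i\beta_i\kappa\zeta/\underline s_i<1$, a step size $\epsilon>0$ and a bound $L$ with $\epsilon L<\zeta$ such that for every trajectory of the recursions that starts at a feasible state: $|\Phi_i|\le L$ along it for all $i$, and for each $i$, (1) if $\bar v_i(t_0)>\zeta$, then $\bar v_i(t_k)\le\zeta$ for all $k$ from some finite index on; (2) if $\bar v_i(t_0)\le\zeta$, then $\bar v_i(t_k)\le\zeta$ for all $k$. Theorem (Synchronous convergence). 1. Under (H1) or (H2), the ODE has a feasible stationary point, and every stationary point (under (H2): every feasible stationary point) $(\mathbf s^*,\bar{\mathbf v}^*)$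 satisfies, for every $i$, $s_i^*=\underline s_i$ and either $\Phi_i(\mathbf s^*,\kappa\bar{\mathbf v}^*)=0$, or $\Phi_i(\mathbf s^*,\kappa\bar{\mathbf v}^*)>0$ and $\bar v_i^*=1/\kappa$. 2. Consider either of the regimes: (i) $\beta_i\kappa/\underline s_i\to 0$ for all $i$, with $n$, $\kappa$ and the $\lambda_i$ fixed; (ii) $n\to\infty$ with $\kappa$ fixed, $\lambda_i\ge\lambda_0$ and $\beta_i\kappa/\underline s_i\le B$ for all $i$, with fixed constants $\lambda_0>0$ and $B$. In (ii), stationary points and initial states are understood to be feasible. (a) Let $w_i=\min\{1/\kappa,\ \lambda_i/\sum_j\lambda_j\}$. For every $\delta>0$, if the $\beta_i\kappa/\underline s_i$ are sufficiently small (depending on $\delta,n,\kappa$ and the $\lambda_i$), respectively if $n$ is sufficiently large (depending on $\delta,\kappa,\lambda_0,B$), then every stationary point satisfies $s_i^*=\underline s_i$ and $|\bar v_i^*-w_i|<\delta$ for all $i$; in (ii) even $|\bar v_i^*-w_i|<\delta\, w_i$. (b) If the $\beta_i\kappa/\underline s_i$ are sufficiently small (depending on $n,\kappa$ and the $\lambda_i$),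 respectively if $n$ is sufficiently large (depending on $\kappa,\lambda_0,B$), then there is exactly one stationary point $(\mathbf s^*,\bar{\mathbf v}^*)$, it is feasible, and there is $\epsilon_0>0$ such that for every $0<\epsilon<\epsilon_0$ and every initial state in $\prod_i\mathcal S_i\times\prod_i\overline{\mathcal V}_i$ (in (ii): every feasible one) the recursions satisfy $(\mathbf s(t_k),\bar{\mathbf v}(t_k))\to(\mathbf s^*,\bar{\mathbf v}^*)$ as $k\to\infty$. -/

import Mathlib

open Filter Topology

/-- A platform with `κ` CPUs shared by `n` applications. Application `i` has the constant `β i` of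
its nominal matching function, the minimum service level `smin i` and the weight `lam i`. -/
structure AppSystem (n : ℕ) where
  κ : ℕ
  β : Fin n → ℝ
  smin : Fin n → ℝ
  lam : Fin n → ℝ
  κ_pos : 0 < κ
  β_pos : ∀ i, 0 < β i
  smin_pos : ∀ i, 0 < smin i
  lam_pos : ∀ i, 0 < lam i
  lam_le_one : ∀ i, lam i ≤ 1

/-- The operator `[x]₋`, equal to `x` for `x ≤ 0` and to `0` for `x > 0`. -/
noncomputable def negTrunc (x : ℝ) : ℝ := if x ≤ 0 then x else 0

namespace AppSystem

variable {n : ℕ} (P : AppSystem n)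

/-- The nominal matching function `φᵢ(sᵢ, vᵢ) = βᵢ vᵢ / sᵢ - 1`. -/
noncomputable def phi (i : Fin n) (s v : ℝ) : ℝ := P.β i * (v / s) - 1

/-- The nominal fairness measure `Φᵢ(s, v)`, where the normalized platform is `v̄ᵢ = vᵢ / κ`. -/
noncomputable def Phi (i : Fin n) (s v : Fin n → ℝ) : ℝ :=
  -(1 - v i / P.κ) * P.lam i * negTrunc (P.phi i (s i) (v i))
    + v i / P.κ * ∑ j ∈ Finset.univ.erase i, P.lam j * negTrunc (P.phi j (s j) (v j))

/-- The unnormalized profile `v = κ v̄`. -/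
def unnorm (vbar : Fin n → ℝ) : Fin n → ℝ := fun i => P.κ * vbar i

/-- The service level profiles: `sᵢ ∈ [sminᵢ, ∞)` for all `i`. -/
def serviceSet : Set (Fin n → ℝ) := {s | ∀ i, s i ∈ Set.Ici (P.smin i)}

/-- The normalized profiles: `v̄ᵢ ∈ [0, 1/κ]` for all `i`. -/
def platformSet : Set (Fin n → ℝ) := {vbar | ∀ i, vbar i ∈ Set.Icc (0 : ℝ) (1 / P.κ)}

/-- The feasible virtual platforms: `v ∈ [0,1]ⁿ` with `∑ vᵢ ≤ κ`. -/
def feasibleSet : Set (Fin n → ℝ) := {v | (∀ i, v i ∈ Set.Icc (0 : ℝ) 1) ∧ ∑ i, v i ≤ P.κ}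

/-! The projected ODE `(sᵢ', v̄ᵢ') = (φᵢ(sᵢ, κ v̄ᵢ), Φᵢ(s, κ v̄)) + zᵢ`. -/

/-- The unprojected vector field of application `i`. -/
noncomputable def field (i : Fin n) (s vbar : Fin n → ℝ) : ℝ × ℝ :=
  (P.phi i (s i) (P.κ * vbar i), P.Phi i s (P.unnorm vbar))

/-- `z` drives the direction `f` at the state `(s, v̄)` of application `i` back to the constraint
set `[sminᵢ, ∞) × [0, 1/κ]`: the corrected direction `f + z` points into that set. -/
def DrivesBack (i : Fin n) (x f z : ℝ × ℝ) : Prop :=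
  f + z ∈ posTangentConeAt (Set.Ici (P.smin i) ×ˢ Set.Icc (0 : ℝ) (1 / P.κ)) x

/-- `z` is the vector of minimum (Euclidean) length that drives the direction `f` back. -/
def IsMinCorrection (i : Fin n) (x f z : ℝ × ℝ) : Prop :=
  P.DrivesBack i x f z ∧
    ∀ z' : ℝ × ℝ, P.DrivesBack i x f z' →
      Real.sqrt (z.1 ^ 2 + z.2 ^ 2) ≤ Real.sqrt (z'.1 ^ 2 + z'.2 ^ 2)

/-- `w` is the value of the right-hand side of the projected ODE for application `i`. -/
def IsOdeRhs (i : Fin n) (s vbar : Fin n → ℝ) (w : ℝ × ℝ) : Prop :=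
  ∃ z : ℝ × ℝ, P.IsMinCorrection i (s i, vbar i) (P.field i s vbar) z ∧
    w = P.field i s vbar + z

/-- Stationary points of the projected ODE: the right-hand side vanishes. -/
def IsStationary (x : (Fin n → ℝ) × (Fin n → ℝ)) : Prop :=
  x.1 ∈ P.serviceSet ∧ x.2 ∈ P.platformSet ∧ ∀ i, P.IsOdeRhs i x.1 x.2 0

/-- The state has a feasible profile of virtual platforms. -/
def IsFeasible (x : (Fin n → ℝ) × (Fin n → ℝ)) : Prop := P.unnorm x.2 ∈ P.feasibleSet

/-- `sᵢ = sminᵢ`, and `Φᵢ = 0` or (`Φᵢ > 0` and `v̄ᵢ = 1/κ`), for all `i`. -/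
def IsBalancedOrCapped (x : (Fin n → ℝ) × (Fin n → ℝ)) : Prop :=
  ∀ i, x.1 i = P.smin i ∧
    (P.Phi i x.1 (P.unnorm x.2) = 0 ∨
      (0 < P.Phi i x.1 (P.unnorm x.2) ∧ x.2 i = 1 / P.κ))

/-- The proportional allocation `min {1/κ, λᵢ / ∑ⱼ λⱼ}`. -/
noncomputable def target (i : Fin n) : ℝ := min (1 / (P.κ : ℝ)) (P.lam i / ∑ j, P.lam j)

/-- The synchronous recursions with constant step size `ε`: the states `x k = (s(t_k), v̄(t_k))`,
with the projections onto `[sminᵢ, ∞)` and `[0, 1/κ]` written out. -/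
structure IsTrajectory (ε : ℝ) (x : ℕ → (Fin n → ℝ) × (Fin n → ℝ)) : Prop where
  init_service : (x 0).1 ∈ P.serviceSet
  init_platform : (x 0).2 ∈ P.platformSet
  step_service : ∀ k i, (x (k + 1)).1 i =
    max (P.smin i) ((x k).1 i + ε * P.phi i ((x k).1 i) (P.κ * (x k).2 i))
  step_platform : ∀ k i, (x (k + 1)).2 i =
    max 0 (min (1 / (P.κ : ℝ)) ((x k).2 i + ε * P.Phi i (x k).1 (P.unnorm (x k).2)))

/-- Hypothesis (H1): `βᵢ / sminᵢ < 1` for all `i`. -/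
def HighDemand : Prop := ∀ i, P.β i / P.smin i < 1

/-- Hypothesis (H2): for some `0 < ζ ≤ 1/κ` with `max βᵢ κ ζ / sminᵢ < 1` and some step size
`ε < ζ / L`, where `L` bounds the observed fairness measures, every trajectory that starts at a
feasible profile satisfies, for each `i`:
(1) if `v̄ᵢ(t₀) > ζ`, then `v̄ᵢ(t_k) ≤ ζ` after a finite `k`;
(2) if `v̄ᵢ(t₀) ≤ ζ`, then `v̄ᵢ(t_k) ≤ ζ` for all `k`. -/
def ManyApplications : Prop :=
  ∃ ζ : ℝ, 0 < ζ ∧ ζ ≤ 1 / P.κ ∧ (∀ i, P.β i * P.κ * ζ / P.smin i - 1 < 0) ∧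
    ∃ ε L : ℝ, 0 < ε ∧ ε * L < ζ ∧
      ∀ x : ℕ → (Fin n → ℝ) × (Fin n → ℝ), P.IsTrajectory ε x → P.IsFeasible (x 0) →
        (∀ k i, |P.Phi i (x k).1 (P.unnorm (x k).2)| ≤ L) ∧
        ∀ i, (ζ < (x 0).2 i → ∃ k₀, ∀ k, k₀ ≤ k → (x k).2 i ≤ ζ) ∧
          ((x 0).2 i ≤ ζ → ∀ k, (x k).2 i ≤ ζ)

end AppSystem

/-! Write `u` for the normalized platforms, `σᵢ = -[φᵢ]₋` for the unmet demands and `S = ∑ λⱼ σⱼ`.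
Then `Φᵢ = λᵢ σᵢ - uᵢ S` (`Phi_unnorm`), so the applications interact only through the scalar `S`.
Stationarity is a complementarity problem (`isStationary_iff`). With `s = smin` and `S` prescribed,
each `uᵢ` is explicit (`share`), and existence reduces to a fixed point of the real function
`response`. This requires neither (H1) nor (H2). The hypotheses only serve to make `φᵢ < 0` at a
stationary point, which forces `sᵢ = sminᵢ`. Small loads, or large total weight together with
feasibility, make `S` relatively close to `∑ λⱼ`. Solving `Φᵢ = 0` for `uᵢ`, with the cap, then
gives nearly proportional allocations (`abs_sub_target_le`). For convergence, `φᵢ ≤ -c` drives the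
service levels to `smin` in finitely many steps. From then on the `ℓ¹` distance of `u` to a feasible
stationary point shrinks by the factor `1 - ε S` (`sum_abs_sub_le`), and `S` is bounded below.
Uniqueness follows, since a stationary point is a constant trajectory. -/

theorem negTrunc_eq_min (x : ℝ) : negTrunc x = min x 0 := by
  unfold negTrunc
  split_ifs with h
  · exact (min_eq_left h).symm
  · exact (min_eq_right (not_le.mp h).le).symm

/-! ### Fairness measure and unmet demand -/

namespace AppSystem

variable {n : ℕ} (P : AppSystem n)

theorem κ_cast_pos : (0 : ℝ) < P.κ := by exact_mod_cast P.κ_pos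

/-- The unmet demand `-[φᵢ]₋` of application `i`. -/
noncomputable def slack (i : Fin n) (s u : Fin n → ℝ) : ℝ :=
  -negTrunc (P.phi i (s i) (P.κ * u i))

/-- The weighted total unmet demand. -/
noncomputable def total (s u : Fin n → ℝ) : ℝ := ∑ j, P.lam j * P.slack j s u

/-- The sum of the weights. -/
noncomputable def weight : ℝ := ∑ j, P.lam j

/-- The load `βᵢ κ / sminᵢ`. -/
noncomputable def load (i : Fin n) : ℝ := P.β i * P.κ / P.smin i

theorem load_pos (i : Fin n) : 0 < P.load i :=
  div_pos (mul_pos (P.β_pos i) P.κ_cast_pos) (P.smin_pos i)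

theorem lam_le_weight (i : Fin n) : P.lam i ≤ P.weight :=
  Finset.single_le_sum (fun j _ => (P.lam_pos j).le) (Finset.mem_univ i)

theorem weight_nonneg : 0 ≤ P.weight := Finset.sum_nonneg fun j _ => (P.lam_pos j).le

/-- The term `vbar i * lam i * negTrunc` inside `-(1 - vbar i)` is exactly the one missing from the
sum over `j ≠ i`; moving it there completes the total. -/
theorem Phi_unnorm (i : Fin n) (s u : Fin n → ℝ) :
    P.Phi i s (P.unnorm u) = P.lam i * P.slack i s u - u i * P.total s u := by
  have hκ := P.κ_cast_pos.ne'
  have hu : P.κ * u i / P.κ = u i := by field_simp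
  unfold Phi total slack unnorm
  rw [hu, ← Finset.add_sum_erase _ _ (Finset.mem_univ i)]
  simp only [mul_neg, Finset.sum_neg_distrib]
  ring

theorem slack_nonneg (i : Fin n) (s u : Fin n → ℝ) : 0 ≤ P.slack i s u := by
  unfold slack; rw [negTrunc_eq_min]
  linarith [min_le_right (P.phi i (s i) (P.κ * u i)) 0]

theorem slack_of_phi_nonpos {i : Fin n} {s u : Fin n → ℝ} (h : P.phi i (s i) (P.κ * u i) ≤ 0) :
    P.slack i s u = -P.phi i (s i) (P.κ * u i) := by
  unfold slack; rw [negTrunc_eq_min, min_eq_left h]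

theorem phi_smin (i : Fin n) (t : ℝ) : P.phi i (P.smin i) (P.κ * t) = P.load i * t - 1 := by
  unfold phi load; ring

theorem phi_le (i : Fin n) {s t : ℝ} (hs : P.smin i ≤ s) (ht : 0 ≤ t) :
    P.phi i s (P.κ * t) ≤ P.load i * t - 1 := by
  rw [← P.phi_smin i t]
  unfold phi
  have h1 := P.smin_pos i
  have h2 := P.β_pos i
  have h3 := P.κ_cast_pos
  gcongr

theorem slack_le_one {i : Fin n} {s u : Fin n → ℝ} (hs : P.smin i ≤ s i) (hu : 0 ≤ u i) :
    P.slack i s u ≤ 1 := by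
  have h1 : -1 ≤ P.phi i (s i) (P.κ * u i) := by
    have : 0 ≤ P.β i * (P.κ * u i / s i) :=
      mul_nonneg (P.β_pos i).le (div_nonneg (mul_nonneg P.κ_cast_pos.le hu)
        ((P.smin_pos i).le.trans hs))
    unfold phi; linarith
  unfold slack; rw [negTrunc_eq_min]
  linarith [le_min h1 (by norm_num : (-1 : ℝ) ≤ 0)]

theorem le_slack {i : Fin n} {s u : Fin n → ℝ} (hs : P.smin i ≤ s i) (hu : 0 ≤ u i) :
    1 - P.load i * u i ≤ P.slack i s u := by
  unfold slack; rw [negTrunc_eq_min]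
  linarith [min_le_left (P.phi i (s i) (P.κ * u i)) 0, P.phi_le i hs hu]

theorem slack_smin (i : Fin n) (u : Fin n → ℝ) :
    P.slack i P.smin u = max 0 (1 - P.load i * u i) := by
  unfold slack
  rw [negTrunc_eq_min, phi_smin, ← max_neg_neg, max_comm]
  norm_num

theorem total_le_weight {s u : Fin n → ℝ} (hs : s ∈ P.serviceSet) (hu : u ∈ P.platformSet) :
    P.total s u ≤ P.weight :=
  Finset.sum_le_sum fun j _ =>
    mul_le_of_le_one_right (P.lam_pos j).le (P.slack_le_one (hs j) (hu j).1)

theorem weight_sub_le_total {s u : Fin n → ℝ} (hs : s ∈ P.serviceSet) (hu : u ∈ P.platformSet) :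
    P.weight - ∑ j, P.lam j * (P.load j * u j) ≤ P.total s u := by
  unfold weight total
  rw [← Finset.sum_sub_distrib]
  refine Finset.sum_le_sum fun j _ => ?_
  have := mul_le_mul_of_nonneg_left (P.le_slack (hs j) (hu j).1) (P.lam_pos j).le
  linarith

theorem isFeasible_iff {x : (Fin n → ℝ) × (Fin n → ℝ)} (hx : x.2 ∈ P.platformSet) :
    P.IsFeasible x ↔ ∑ i, x.2 i ≤ 1 := by
  have hκ := P.κ_cast_pos
  unfold IsFeasible feasibleSet unnorm
  simp only [Set.mem_ofPred_eq, ← Finset.mul_sum]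
  refine ⟨fun h => by nlinarith [h.2], fun h => ⟨fun i => ⟨mul_nonneg hκ.le (hx i).1, ?_⟩, ?_⟩⟩
  · have := (le_div_iff₀ hκ).1 (hx i).2
    linarith
  · nlinarith

/-! ### Stationary points as solutions of a complementarity problem -/

/-- A direction `f` in the normal cone satisfies `⟨f, w⟩ ≤ 0` for every tangent `w`. Any admissible
correction is `z = w - f`, so `|z|² = |w|² - 2⟨f, w⟩ + |f|² ≥ |f|²`, and `-f` is shortest. -/
theorem isOdeRhs_zero_of_normal {i : Fin n} {s u : Fin n → ℝ}
    (h : ∀ y ∈ Set.Ici (P.smin i) ×ˢ Set.Icc (0 : ℝ) (1 / P.κ),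
      (P.field i s u).1 * (y.1 - s i) + (P.field i s u).2 * (y.2 - u i) ≤ 0)
    (hx : (s i, u i) ∈ Set.Ici (P.smin i) ×ˢ Set.Icc (0 : ℝ) (1 / P.κ)) :
    P.IsOdeRhs i s u 0 := by
  set f := P.field i s u with hf
  refine ⟨-f, ⟨?_, fun z hz => ?_⟩, by simp [← hf]⟩
  · unfold DrivesBack
    rw [add_neg_cancel]
    refine mem_posTangentConeAt_of_segment_subset ?_
    simpa using hx
  · let g : ℝ × ℝ →L[ℝ] ℝ := f.1 • ContinuousLinearMap.fst ℝ ℝ ℝ + f.2 • ContinuousLinearMap.snd ℝ ℝ ℝ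
    -- The first-order condition at the maximum of the linear form `g` carries the inequality from
    -- points of the set to tangent directions.
    have hmax : IsLocalMaxOn g (Set.Ici (P.smin i) ×ˢ Set.Icc (0 : ℝ) (1 / P.κ)) (s i, u i) := by
      refine eventually_nhdsWithin_of_forall fun y hy => ?_
      have := h y hy
      simp only [g, add_apply, smul_apply,
        ContinuousLinearMap.coe_fst', ContinuousLinearMap.coe_snd', smul_eq_mul]
      linarith
    have h0 := hmax.hasFDerivWithinAt_nonpos g.hasFDerivAt.hasFDerivWithinAt hz
    simp only [g, add_apply, smul_apply,
      ContinuousLinearMap.coe_fst', ContinuousLinearMap.coe_snd', smul_eq_mul, Prod.fst_add,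
      Prod.snd_add] at h0
    refine Real.sqrt_le_sqrt ?_
    simp only [Prod.fst_neg, Prod.snd_neg]
    nlinarith [sq_nonneg (f.1 + z.1), sq_nonneg (f.2 + z.2)]

/-- For a product of intervals the normal cone is described coordinatewise. If one component of the
field pointed into its interval, moving along that component alone would give a correction shorter
than `-f`. -/
theorem isStationary_iff (x : (Fin n → ℝ) × (Fin n → ℝ)) :
    P.IsStationary x ↔ x.1 ∈ P.serviceSet ∧ x.2 ∈ P.platformSet ∧ ∀ i,
      P.phi i (x.1 i) (P.κ * x.2 i) ≤ 0 ∧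
      (P.phi i (x.1 i) (P.κ * x.2 i) = 0 ∨ x.1 i = P.smin i) ∧
      (P.Phi i x.1 (P.unnorm x.2) ≤ 0 ∨ x.2 i = 1 / P.κ) ∧
      (0 ≤ P.Phi i x.1 (P.unnorm x.2) ∨ x.2 i = 0) := by
  refine and_congr_right fun hs => and_congr_right fun hu => forall_congr' fun i => ?_
  have hsi : P.smin i ≤ x.1 i := hs i
  obtain ⟨hu0, hu1⟩ := hu i
  constructor
  · rintro ⟨z, ⟨-, hmin⟩, hw⟩
    have hz : z = -P.field i x.1 x.2 := by
      rw [eq_neg_iff_add_eq_zero, add_comm]; exact hw.symm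
    -- Minimality of `-f` is tested against the correction `w - f`, for directions `w` along which
    -- the set is not left immediately.
    have key : ∀ w : ℝ × ℝ, (∃ᶠ t : ℝ in 𝓝[>] 0, (x.1 i, x.2 i) + t • w ∈
        Set.Ici (P.smin i) ×ˢ Set.Icc (0 : ℝ) (1 / P.κ)) →
        (P.field i x.1 x.2).1 ^ 2 + (P.field i x.1 x.2).2 ^ 2 ≤
          (w.1 - (P.field i x.1 x.2).1) ^ 2 + (w.2 - (P.field i x.1 x.2).2) ^ 2 := by
      intro w hw
      have h1 := hmin (w - P.field i x.1 x.2) (by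
        unfold DrivesBack
        rw [add_sub_cancel]
        exact mem_posTangentConeAt_of_frequently_mem hw)
      rw [Real.sqrt_le_sqrt_iff (by positivity), hz] at h1
      simpa using h1
    have small : ∀ (r d : ℝ), 0 < d → ∀ᶠ t : ℝ in 𝓝[>] 0, 0 < t ∧ t * r < d := by
      intro r d hd
      refine (eventually_mem_nhdsWithin).and (Filter.Eventually.filter_mono nhdsWithin_le_nhds ?_)
      have : Tendsto (fun t : ℝ => t * r) (𝓝 0) (𝓝 (0 * r)) := tendsto_id.mul_const r
      rw [zero_mul] at this
      exact this.eventually_lt_const hd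
    have service : ∀ r : ℝ, (∀ᶠ t : ℝ in 𝓝[>] 0, P.smin i ≤ x.1 i + t * r) →
        r = P.phi i (x.1 i) (P.κ * x.2 i) → r = 0 := by
      intro r hr hr'
      have := key (r, 0) (Eventually.frequently (hr.mono fun t ht => by
        simp only [Prod.smul_mk, Prod.mk_add_mk, smul_eq_mul, mul_zero, add_zero]
        exact ⟨ht, hu0, hu1⟩))
      simp only [field, ← hr', sub_self, zero_sub] at this
      have : r ^ 2 ≤ 0 := by nlinarith
      exact pow_eq_zero_iff (two_ne_zero) |>.1 (le_antisymm this (sq_nonneg _))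
    have platform : ∀ r : ℝ, (∀ᶠ t : ℝ in 𝓝[>] 0, x.2 i + t * r ∈ Set.Icc (0 : ℝ) (1 / P.κ)) →
        r = P.Phi i x.1 (P.unnorm x.2) → r = 0 := by
      intro r hr hr'
      have := key (0, r) (Eventually.frequently (hr.mono fun t ht => by
        simp only [Prod.smul_mk, Prod.mk_add_mk, smul_eq_mul, mul_zero, add_zero]
        exact ⟨hsi, ht⟩))
      simp only [field, ← hr', sub_self, zero_sub] at this
      have : r ^ 2 ≤ 0 := by nlinarith
      exact pow_eq_zero_iff (two_ne_zero) |>.1 (le_antisymm this (sq_nonneg _))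
    refine ⟨?_, ?_, ?_, ?_⟩
    · by_contra! hc
      refine hc.ne' (service _ ?_ rfl)
      filter_upwards [self_mem_nhdsWithin] with t ht
      have := mul_pos (Set.mem_Ioi.1 ht) hc
      linarith
    · rcases hsi.eq_or_lt with h | h
      · exact Or.inr h.symm
      · refine Or.inl (service _ ?_ rfl)
        filter_upwards [small (-P.phi i (x.1 i) (P.κ * x.2 i)) _ (sub_pos.2 h)] with t ht
        linarith [ht.2]
    · rcases hu1.eq_or_lt with h | h
      · exact Or.inr h
      · refine Or.inl (not_lt.1 fun hc => hc.ne' (platform _ ?_ rfl))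
        filter_upwards [small (P.Phi i x.1 (P.unnorm x.2)) _ (sub_pos.2 h)] with t ht
        have := mul_pos ht.1 hc
        exact ⟨by linarith, by linarith [ht.2]⟩
    · rcases hu0.eq_or_lt with h | h
      · exact Or.inr h.symm
      · refine Or.inl (not_lt.1 fun hc => hc.ne (platform _ ?_ rfl))
        filter_upwards [small (-P.Phi i x.1 (P.unnorm x.2)) _ h] with t ht
        have := mul_pos ht.1 (neg_pos.2 hc)
        exact ⟨by linarith [ht.2], by linarith⟩
  · rintro ⟨h1, h2, h3, h4⟩
    refine P.isOdeRhs_zero_of_normal (fun y hy => ?_) ⟨hsi, hu0, hu1⟩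
    obtain ⟨hy1, hy2, hy3⟩ := hy
    have e1 : P.phi i (x.1 i) (P.κ * x.2 i) * (y.1 - x.1 i) ≤ 0 := by
      rcases h2 with h | h
      · rw [h, zero_mul]
      · exact mul_nonpos_of_nonpos_of_nonneg h1 (sub_nonneg.2 (h ▸ hy1))
    have e2 : P.Phi i x.1 (P.unnorm x.2) * (y.2 - x.2 i) ≤ 0 := by
      rcases le_total (P.Phi i x.1 (P.unnorm x.2)) 0 with h | h
      · rcases h4 with h' | h'
        · rw [le_antisymm h h', zero_mul]
        · exact mul_nonpos_of_nonpos_of_nonneg h (by rw [h']; linarith)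
      · rcases h3 with h' | h'
        · rw [le_antisymm h' h, zero_mul]
        · exact mul_nonpos_of_nonneg_of_nonpos h (by rw [h']; linarith)
    exact add_nonpos e1 e2

/-! ### Existence of a feasible stationary point -/

/-- The allocation of application `i` when the total unmet demand is `S`. -/
noncomputable def share (i : Fin n) (S : ℝ) : ℝ :=
  min (1 / (P.κ : ℝ)) (P.lam i / (S + P.lam i * P.load i))

/-- The total unmet demand produced by the allocations `share i S`. -/
noncomputable def response (S : ℝ) : ℝ := ∑ i, P.lam i * (1 - P.load i * P.share i S)

theorem denom_pos (i : Fin n) {S : ℝ} (hS : 0 ≤ S) : 0 < S + P.lam i * P.load i :=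
  add_pos_of_nonneg_of_pos hS (mul_pos (P.lam_pos i) (P.load_pos i))

theorem share_nonneg (i : Fin n) {S : ℝ} (hS : 0 ≤ S) : 0 ≤ P.share i S :=
  le_min (by positivity) (div_nonneg (P.lam_pos i).le (P.denom_pos i hS).le)

/-- This inequality says `Φᵢ ≥ 0` when the total is `S`; equality can fail only at the cap. -/
theorem share_mul_le (i : Fin n) {S : ℝ} (hS : 0 ≤ S) :
    P.share i S * S ≤ P.lam i * (1 - P.load i * P.share i S) := by
  have : P.share i S * (S + P.lam i * P.load i) ≤ P.lam i :=
    (le_div_iff₀ (P.denom_pos i hS)).1 (min_le_right _ _)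
  linarith

theorem share_mul_eq (i : Fin n) {S : ℝ} (hS : 0 ≤ S) :
    P.share i S * S = P.lam i * (1 - P.load i * P.share i S) ∨ P.share i S = 1 / P.κ := by
  rcases min_choice (1 / (P.κ : ℝ)) (P.lam i / (S + P.lam i * P.load i)) with h | h
  · exact Or.inr h
  · have : P.share i S * (S + P.lam i * P.load i) = P.lam i :=
      (eq_div_iff (P.denom_pos i hS).ne').1 h
    exact Or.inl (by linarith)

theorem load_mul_share_le (i : Fin n) {S : ℝ} (hS : 0 ≤ S) : P.load i * P.share i S ≤ 1 := by
  have h1 := P.share_mul_le i hS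
  have h2 := mul_nonneg (P.share_nonneg i hS) hS
  have := nonneg_of_mul_nonneg_right (h2.trans h1) (P.lam_pos i)
  linarith

theorem continuousOn_share (i : Fin n) : ContinuousOn (P.share i) (Set.Ici 0) :=
  continuousOn_const.inf (continuousOn_const.div (by fun_prop) fun _ hS => (P.denom_pos i hS).ne')

theorem continuousOn_response : ContinuousOn P.response (Set.Ici 0) := by
  unfold response
  have := P.continuousOn_share
  fun_prop

theorem response_le_weight {S : ℝ} (hS : 0 ≤ S) : P.response S ≤ P.weight :=
  Finset.sum_le_sum fun i _ => mul_le_of_le_one_right (P.lam_pos i).le (by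
    have := mul_nonneg (P.load_pos i).le (P.share_nonneg i hS)
    linarith)

theorem sum_share_mul_le {S : ℝ} (hS : 0 ≤ S) : (∑ i, P.share i S) * S ≤ P.response S := by
  rw [Finset.sum_mul]
  exact Finset.sum_le_sum fun i _ => P.share_mul_le i hS

theorem share_mem_platformSet {S : ℝ} (hS : 0 ≤ S) : (fun i => P.share i S) ∈ P.platformSet :=
  fun i => ⟨P.share_nonneg i hS, min_le_left _ _⟩

theorem isStationary_share {S : ℝ} (hS : 0 ≤ S) (h : P.response S = S) :
    P.IsStationary (P.smin, fun i => P.share i S) := by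
  have hphi : ∀ i, P.phi i (P.smin i) (P.κ * P.share i S) ≤ 0 := fun i => by
    rw [phi_smin]; linarith [P.load_mul_share_le i hS]
  have hslack : ∀ i, P.slack i P.smin (fun i => P.share i S) = 1 - P.load i * P.share i S :=
    fun i => by
      rw [slack_smin, max_eq_right]; linarith [P.load_mul_share_le i hS]
  have htot : P.total P.smin (fun i => P.share i S) = S := by
    unfold total; simp only [hslack]; exact h
  refine (P.isStationary_iff _).2 ⟨fun i => Set.self_mem_Ici, P.share_mem_platformSet hS,
    fun i => ⟨hphi i, Or.inr rfl, ?_, Or.inl ?_⟩⟩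
  · simp only [Phi_unnorm, htot, hslack]
    exact (P.share_mul_eq i hS).imp_left fun h => by linarith
  · simp only [Phi_unnorm, htot, hslack]
    linarith [P.share_mul_le i hS]

/-- `response` is continuous on `[0, ∞)` and bounded by `weight`, so it crosses the diagonal or lies
below it on `(0, ∞)`. At a positive fixed point, summing `share i S * S ≤ …` and dividing by `S`
gives feasibility; at `S = 0` feasibility is obtained as a limit. -/
theorem exists_isStationary_isFeasible : ∃ x, P.IsStationary x ∧ P.IsFeasible x := by
  by_cases h : ∃ S, 0 < S ∧ S ≤ P.response S
  · obtain ⟨S₀, hS₀, hle⟩ := h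
    have hcont : ContinuousOn (fun S => P.response S - S) (Set.Icc S₀ (max S₀ P.weight)) :=
      (P.continuousOn_response.mono fun S hS => hS₀.le.trans hS.1).sub continuousOn_id
    obtain ⟨S, hS, hzero⟩ := intermediate_value_Icc' (le_max_left _ _) hcont
      (show (0 : ℝ) ∈ _ from ⟨by
        have := P.response_le_weight (hS₀.le.trans (le_max_left S₀ P.weight))
        linarith [le_max_right S₀ P.weight], by linarith⟩)
    have hpos : 0 < S := hS₀.trans_le hS.1
    have heq : P.response S = S := sub_eq_zero.1 hzero
    refine ⟨_, P.isStationary_share hpos.le heq,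
      (P.isFeasible_iff (P.share_mem_platformSet hpos.le)).2 ?_⟩
    have := P.sum_share_mul_le hpos.le
    rw [heq] at this
    exact le_of_mul_le_mul_right (by simpa using this) hpos
  -- Here `response S < S` for all `S > 0`. Letting `S → 0` gives `response 0 = 0`, and the bound `∑
  -- share ≤ 1`, valid for `S > 0`, passes to the limit.
  · push Not at h
    have hsum : ContinuousOn (fun S => ∑ i, P.share i S) (Set.Ici 0) := by
      have := P.continuousOn_share
      fun_prop
    have hresp0 : P.response 0 ≤ 0 :=
      le_of_tendsto_of_tendsto
        ((P.continuousOn_response 0 Set.self_mem_Ici).mono_left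
          (nhdsWithin_mono _ Set.Ioi_subset_Ici_self))
        (tendsto_id.mono_left (nhdsWithin_le_nhds (s := Set.Ioi (0 : ℝ))))
        (by filter_upwards [self_mem_nhdsWithin] with S hS using (h S hS).le)
    have hsum0 : ∑ i, P.share i 0 ≤ 1 :=
      le_of_tendsto
        ((hsum 0 Set.self_mem_Ici).mono_left (nhdsWithin_mono _ Set.Ioi_subset_Ici_self))
        (by
          filter_upwards [self_mem_nhdsWithin] with S hS
          have hS : 0 < S := hS
          have := (P.sum_share_mul_le hS.le).trans (h S hS).le
          exact le_of_mul_le_mul_right (by simpa using this) hS)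
    have hnonneg : 0 ≤ P.response 0 := by simpa using P.sum_share_mul_le le_rfl
    exact ⟨_, P.isStationary_share le_rfl (le_antisymm hresp0 hnonneg),
      (P.isFeasible_iff (P.share_mem_platformSet le_rfl)).2 hsum0⟩

/-! ### Signs at stationary points -/

/-- A negative value would be possible only at `u i = 0`, where `Φᵢ = λᵢ σᵢ ≥ 0`. -/
theorem IsStationary.Phi_nonneg {P : AppSystem n} {x : (Fin n → ℝ) × (Fin n → ℝ)}
    (hx : P.IsStationary x) (i : Fin n) : 0 ≤ P.Phi i x.1 (P.unnorm x.2) := by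
  refine (((P.isStationary_iff x).1 hx).2.2 i).2.2.2.elim id fun h => ?_
  rw [Phi_unnorm, h, zero_mul, sub_zero]
  exact mul_nonneg (P.lam_pos i).le (P.slack_nonneg i _ _)

theorem IsStationary.isBalancedOrCapped {P : AppSystem n} {x : (Fin n → ℝ) × (Fin n → ℝ)}
    (hx : P.IsStationary x) (hneg : ∀ i, P.phi i (x.1 i) (P.κ * x.2 i) < 0) :
    P.IsBalancedOrCapped x := by
  intro i
  obtain ⟨hs, hu, h⟩ := (P.isStationary_iff x).1 hx
  obtain ⟨-, h2, h3, -⟩ := h i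
  refine ⟨h2.resolve_left (hneg i).ne, (hx.Phi_nonneg i).eq_or_lt.imp Eq.symm fun hpos => ⟨hpos, ?_⟩⟩
  exact h3.resolve_left (not_le.2 hpos)

end AppSystem

namespace AppSystem

variable {n : ℕ} {P : AppSystem n}

/-! ### Trajectories -/

theorem IsTrajectory.mem {ε : ℝ} {x : ℕ → (Fin n → ℝ) × (Fin n → ℝ)} (hx : P.IsTrajectory ε x)
    (k : ℕ) : (x k).1 ∈ P.serviceSet ∧ (x k).2 ∈ P.platformSet := by
  cases k with
  | zero => exact ⟨hx.init_service, hx.init_platform⟩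
  | succ k =>
    refine ⟨fun i => ?_, fun i => ?_⟩
    · rw [hx.step_service]; exact Set.mem_Ici.2 (le_max_left _ _)
    · rw [hx.step_platform]
      exact ⟨le_max_left _ _, max_le (one_div_nonneg.2 P.κ_cast_pos.le) (min_le_left _ _)⟩

theorem IsStationary.platform_eq {x : (Fin n → ℝ) × (Fin n → ℝ)} (hx : P.IsStationary x) {ε : ℝ}
    (hε : 0 < ε) (i : Fin n) :
    x.2 i = max 0 (min (1 / (P.κ : ℝ)) (x.2 i + ε * P.Phi i x.1 (P.unnorm x.2))) := by
  obtain ⟨-, hu, h⟩ := (P.isStationary_iff x).1 hx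
  obtain ⟨-, -, h3, h4⟩ := h i
  obtain ⟨hu0, hu1⟩ := hu i
  rcases lt_trichotomy (P.Phi i x.1 (P.unnorm x.2)) 0 with hlt | heq | hgt
  · have hz := h4.resolve_left (not_le.2 hlt)
    have := mul_neg_of_pos_of_neg hε hlt
    rw [max_eq_left ((min_le_right _ _).trans (by linarith)), hz]
  · rw [heq, mul_zero, add_zero, min_eq_right hu1, max_eq_right hu0]
  · have hz := h3.resolve_left (not_le.2 hgt)
    have := mul_pos hε hgt
    rw [min_eq_left (by linarith), max_eq_right (by positivity), hz]

theorem IsStationary.isTrajectory_const {x : (Fin n → ℝ) × (Fin n → ℝ)} (hx : P.IsStationary x)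
    {ε : ℝ} (hε : 0 < ε) : P.IsTrajectory ε fun _ => x := by
  refine ⟨hx.1, hx.2.1, fun _ i => ?_, fun _ i => hx.platform_eq hε i⟩
  obtain ⟨hs, -, h⟩ := (P.isStationary_iff x).1 hx
  have hsi : P.smin i ≤ x.1 i := hs i
  obtain ⟨h1, h2, -⟩ := h i
  rcases h2 with h | h
  · simp [h, hsi]
  · simp only [h] at h1 ⊢
    rw [max_eq_left]
    have := mul_nonpos_of_nonneg_of_nonpos hε.le h1
    linarith

/-! ### Stationary points under (H1) and (H2) -/

theorem isBalancedOrCapped_of_highDemand (hP : P.HighDemand) {x : (Fin n → ℝ) × (Fin n → ℝ)}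
    (hx : P.IsStationary x) : P.IsBalancedOrCapped x := by
  refine hx.isBalancedOrCapped fun i => ?_
  have h1 := P.phi_le i (hx.1 i) (hx.2.1 i).1
  have h2 : P.load i * x.2 i ≤ P.load i * (1 / P.κ) :=
    mul_le_mul_of_nonneg_left (hx.2.1 i).2 (P.load_pos i).le
  have h3 : P.load i * (1 / P.κ) = P.β i / P.smin i := by
    have := P.κ_cast_pos.ne'
    unfold load; field_simp
  linarith [hP i]

theorem isBalancedOrCapped_of_manyApplications (hP : P.ManyApplications)
    {x : (Fin n → ℝ) × (Fin n → ℝ)} (hx : P.IsStationary x) (hf : P.IsFeasible x) :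
    P.IsBalancedOrCapped x := by
  obtain ⟨ζ, -, -, hζ, ε, L, hε, -, h⟩ := hP
  -- A constant trajectory never descends below `ζ`, so (1) excludes `ζ < x.2 i`.
  have hconst := (h _ (hx.isTrajectory_const hε) hf).2
  have hle : ∀ i, x.2 i ≤ ζ := fun i => by
    by_contra! hc
    obtain ⟨k, hk⟩ := (hconst i).1 hc
    exact absurd (hk k le_rfl) (not_le.2 hc)
  refine hx.isBalancedOrCapped fun i => ?_
  have h1 := P.phi_le i (hx.1 i) (hx.2.1 i).1
  have h2 := mul_le_mul_of_nonneg_left (hle i) (P.load_pos i).le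
  have h3 : P.load i * ζ = P.β i * P.κ * ζ / P.smin i := by unfold load; ring
  linarith [hζ i]

/-! ### Closeness to the proportional allocation -/

/-- If the loads absorb at most `E` of the weighted demand, a stationary point is proportional up
to the relative error `E / (weight - E)`. -/
theorem IsStationary.abs_sub_target_le {x : (Fin n → ℝ) × (Fin n → ℝ)} (hx : P.IsStationary x)
    (hneg : ∀ i, P.phi i (x.1 i) (P.κ * x.2 i) < 0) {E : ℝ} (hE : E < P.weight)
    (hsum : ∑ j, P.lam j * (P.load j * x.2 j) ≤ E) {i : Fin n} (hi : P.lam i * P.load i ≤ E) :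
    |x.2 i - P.target i| ≤ P.lam i / P.weight * (E / (P.weight - E)) := by
  have hbal := hx.isBalancedOrCapped hneg
  have hs : x.1 = P.smin := funext fun i => (hbal i).1
  have hslack : P.slack i x.1 x.2 = 1 - P.load i * x.2 i := by
    rw [P.slack_of_phi_nonpos (hneg i).le, (hbal i).1, phi_smin]; ring
  have hT1 := P.weight_sub_le_total hx.1 hx.2.1
  have hT2 := P.total_le_weight hx.1 hx.2.1
  have hlam := P.lam_pos i
  have hE0 : 0 < E := (mul_pos hlam (P.load_pos i)).trans_le hi
  have hW : 0 < P.weight := hE0.trans hE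
  set D := P.total x.1 x.2 + P.lam i * P.load i with hD
  have hDE : P.weight - E ≤ D := by
    linarith [mul_pos hlam (P.load_pos i)]
  have hDpos : 0 < D := (sub_pos.2 hE).trans_le hDE
  have hxi : x.2 i = min (1 / (P.κ : ℝ)) (P.lam i / D) := by
    have hb := (hbal i).2
    rw [Phi_unnorm, hslack] at hb
    rcases hb with h | ⟨h, h'⟩
    · have : x.2 i = P.lam i / D := by
        rw [eq_div_iff hDpos.ne', hD]; linarith
      rw [← this]; exact (min_eq_right (hx.2.1 i).2).symm
    · rw [← h']
      refine (min_eq_left ?_).symm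
      rw [le_div_iff₀ hDpos, hD]; linarith
  have hdiff : P.lam i / D - P.lam i / P.weight = P.lam i / P.weight * ((P.weight - D) / D) := by
    field_simp
  -- `D` exceeds `weight` by at most `λᵢ load i ≤ E`, and falls short of it by at most the absorbed
  -- demand, again at most `E`.
  have habs : |P.weight - D| ≤ E := abs_le.2 ⟨by linarith, by linarith⟩
  calc |x.2 i - P.target i| ≤ |P.lam i / D - P.lam i / P.weight| := by
        rw [hxi]
        refine (abs_min_sub_min_le_max _ _ _ _).trans ?_
        rw [sub_self, abs_zero]
        exact max_le (abs_nonneg _) le_rfl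
    _ = P.lam i / P.weight * (|P.weight - D| / D) := by
        rw [hdiff, abs_mul, abs_div (P.weight - D), abs_of_pos hDpos, abs_of_pos (div_pos hlam hW)]
    _ ≤ _ := by
        have := sub_pos.2 hE
        gcongr

/-! ### Convergence of the recursions -/

theorem IsTrajectory.eventually_service_eq {ε : ℝ} (hε : 0 < ε)
    {x : ℕ → (Fin n → ℝ) × (Fin n → ℝ)} (hx : P.IsTrajectory ε x) {c : ℝ} (hc : 0 < c) {K : ℕ}
    (hphi : ∀ k, K ≤ k → ∀ i, P.phi i ((x k).1 i) (P.κ * (x k).2 i) ≤ -c) :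
    ∀ᶠ k in atTop, (x k).1 = P.smin := by
  have hdecr : ∀ i m, (x (K + m)).1 i ≤ max (P.smin i) ((x K).1 i - m * (ε * c)) := by
    intro i m
    induction m with
    | zero => simp
    | succ m ih =>
      rw [← add_assoc, hx.step_service]
      refine max_le (le_max_left _ _) ?_
      have h1 := mul_le_mul_of_nonneg_left (hphi (K + m) (by omega) i) hε.le
      have h2 := mul_pos hε hc
      push_cast
      rcases le_max_iff.1 ih with h | h
      · exact le_max_of_le_left (by linarith)
      · exact le_max_of_le_right (by linarith)
  have hev : ∀ i, ∀ᶠ m : ℕ in atTop, (x K).1 i - m * (ε * c) ≤ P.smin i := by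
    intro i
    have := (tendsto_natCast_atTop_atTop (R := ℝ)).atTop_mul_const (mul_pos hε hc)
    filter_upwards [this.eventually_ge_atTop ((x K).1 i - P.smin i)] with m hm
    linarith
  have hall : ∀ᶠ m : ℕ in atTop, (x (m + K)).1 = P.smin := by
    filter_upwards [eventually_all.2 hev] with m hm
    funext i
    refine le_antisymm ?_ ((hx.mem _).1 i)
    rw [add_comm]
    exact (hdecr i m).trans (max_le le_rfl (hm i))
  obtain ⟨M, hM⟩ := eventually_atTop.1 hall
  refine eventually_atTop.2 ⟨M + K, fun k hk => ?_⟩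
  have := hM (k - K) (by omega)
  rwa [Nat.sub_add_cancel (by omega)] at this

/-- The two increments have opposite signs, and `b * c ≤ a` lets the first dominate, so the absolute
values subtract. The negative term gained here pays for the coupling through the total. -/
theorem abs_mul_add_mul_max_sub_le {a b c d e : ℝ} (hb : 0 ≤ b) (hc : 0 ≤ c) (h : b * c ≤ a) :
    |a * (d - e) + b * (max 0 (1 - c * d) - max 0 (1 - c * e))| ≤
      a * |d - e| - b * |max 0 (1 - c * d) - max 0 (1 - c * e)| := by
  wlog hde : e ≤ d generalizing d e
  · have := this (d := e) (e := d) (le_of_not_ge hde)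
    rw [abs_sub_comm d e, abs_sub_comm (max 0 (1 - c * d)), ← abs_neg]
    refine le_of_eq_of_le (congrArg _ ?_) this
    ring
  have hcd : c * e ≤ c * d := mul_le_mul_of_nonneg_left hde hc
  have h1 : max 0 (1 - c * d) ≤ max 0 (1 - c * e) := max_le_max le_rfl (by linarith)
  have h2 : max 0 (1 - c * e) ≤ max 0 (1 - c * d) + c * (d - e) :=
    max_le (add_nonneg (le_max_left _ _) (by linarith))
      (by linarith [le_max_right 0 (1 - c * d)])
  have h3 := mul_le_mul_of_nonneg_left h2 hb
  have h4 := mul_le_mul_of_nonneg_right h (sub_nonneg.2 hde)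
  have h5 : 0 ≤ a * (d - e) + b * (max 0 (1 - c * d) - max 0 (1 - c * e)) := by linarith
  rw [abs_of_nonneg h5, abs_of_nonneg (sub_nonneg.2 hde), abs_of_nonpos (sub_nonpos.2 h1)]
  linarith

/-- Before projection, the error of application `i` becomes `(1 - ε S)(xᵢ - yᵢ) + ε λᵢ gᵢ - ε yᵢ (S
- T)`. The middle term contributes `-ε λᵢ |gᵢ|`. Since `∑ yᵢ ≤ 1` and `|S - T| ≤ ∑ λᵢ |gᵢ|`, these
gains cancel the last terms after summation. Only `y` has to be feasible, not the trajectory. -/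
theorem IsTrajectory.sum_abs_sub_le {ε : ℝ} (hε : 0 < ε)
    (hε' : ∀ i, ε * (P.weight + P.lam i * P.load i) ≤ 1)
    {x : ℕ → (Fin n → ℝ) × (Fin n → ℝ)} (hx : P.IsTrajectory ε x)
    {y : (Fin n → ℝ) × (Fin n → ℝ)} (hy : P.IsStationary y) (hyf : P.IsFeasible y)
    (hys : y.1 = P.smin) {k : ℕ} (hk : (x k).1 = P.smin) :
    ∑ i, |(x (k + 1)).2 i - y.2 i| ≤
      (1 - ε * P.total (x k).1 (x k).2) * ∑ i, |(x k).2 i - y.2 i| := by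
  obtain ⟨hs, hu⟩ := hx.mem k
  set S := P.total (x k).1 (x k).2 with hS
  set T := P.total y.1 y.2 with hT
  set g := fun i => P.slack i (x k).1 (x k).2 - P.slack i y.1 y.2 with hg
  have hSW : S ≤ P.weight := P.total_le_weight hs hu
  have hST : |S - T| ≤ ∑ i, P.lam i * |g i| := by
    rw [hS, hT, total, total, ← Finset.sum_sub_distrib]
    refine (Finset.abs_sum_le_sum_abs _ _).trans (Finset.sum_le_sum fun i _ => ?_)
    rw [← mul_sub, abs_mul, abs_of_pos (P.lam_pos i)]
  have hstep : ∀ i, |(x (k + 1)).2 i - y.2 i| ≤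
      (1 - ε * S) * |(x k).2 i - y.2 i| - ε * (P.lam i * |g i|) + ε * (y.2 i * |S - T|) := by
    intro i
    have hle := mul_le_mul_of_nonneg_left hSW hε.le
    have hkey := abs_mul_add_mul_max_sub_le (a := 1 - ε * S) (b := ε * P.lam i)
      (c := P.load i) (d := (x k).2 i) (e := y.2 i) (mul_pos hε (P.lam_pos i)).le
      (P.load_pos i).le (by linarith [hε' i])
    rw [← slack_smin, ← slack_smin] at hkey
    have hgi : g i = P.slack i P.smin (x k).2 - P.slack i P.smin y.2 := by
      rw [hg, hk, hys]
    rw [← hgi] at hkey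
    have hyi := (hy.2.1 i).1
    calc |(x (k + 1)).2 i - y.2 i|
        ≤ |((x k).2 i + ε * P.Phi i (x k).1 (P.unnorm (x k).2)) -
            (y.2 i + ε * P.Phi i y.1 (P.unnorm y.2))| := by
          have heq := congrArg (fun t => |(x (k + 1)).2 i - t|) (hy.platform_eq hε i)
          refine heq.le.trans ?_
          rw [hx.step_platform]
          refine (abs_max_sub_max_le_max _ _ _ _).trans (max_le (by simp) ?_)
          refine (abs_min_sub_min_le_max _ _ _ _).trans (max_le (by simp) le_rfl)
      _ = |((1 - ε * S) * ((x k).2 i - y.2 i) + ε * P.lam i * g i) - ε * (y.2 i * (S - T))| := by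
          rw [Phi_unnorm, Phi_unnorm, ← hS, ← hT, hg]
          congr 1; ring
      _ ≤ _ := by
          refine (abs_sub _ _).trans ?_
          rw [abs_mul ε, abs_mul (y.2 i), abs_of_pos hε, abs_of_nonneg hyi]
          linarith
  have hy1 : ∑ i, y.2 i ≤ 1 := (P.isFeasible_iff hy.2.1).1 hyf
  calc _ ≤ ∑ i, ((1 - ε * S) * |(x k).2 i - y.2 i| - ε * (P.lam i * |g i|) +
          ε * (y.2 i * |S - T|)) := Finset.sum_le_sum fun i _ => hstep i
    _ = (1 - ε * S) * ∑ i, |(x k).2 i - y.2 i| - ε * ∑ i, P.lam i * |g i| +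
          ε * ((∑ i, y.2 i) * |S - T|) := by
        rw [Finset.sum_add_distrib, Finset.sum_sub_distrib, ← Finset.mul_sum, ← Finset.mul_sum,
          ← Finset.mul_sum, ← Finset.sum_mul]
    _ ≤ _ := by
        have h1 := mul_le_mul_of_nonneg_right hy1 (abs_nonneg (S - T))
        have h2 := mul_le_mul_of_nonneg_left (h1.trans ((one_mul _).le.trans hST)) hε.le
        linarith

theorem IsTrajectory.tendsto {ε : ℝ} (hε : 0 < ε)
    (hε' : ∀ i, ε * (P.weight + P.lam i * P.load i) ≤ 1)
    {x : ℕ → (Fin n → ℝ) × (Fin n → ℝ)} (hx : P.IsTrajectory ε x)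
    {y : (Fin n → ℝ) × (Fin n → ℝ)} (hy : P.IsStationary y) (hyf : P.IsFeasible y)
    (hys : y.1 = P.smin) {c σ : ℝ} (hc : 0 < c) (hσ : 0 < σ) {K : ℕ}
    (hphi : ∀ k, K ≤ k → ∀ i, P.phi i ((x k).1 i) (P.κ * (x k).2 i) ≤ -c)
    (htot : ∀ k, σ ≤ P.total (x k).1 (x k).2) :
    Tendsto x atTop (𝓝 y) := by
  have hserv := hx.eventually_service_eq hε hc hphi
  obtain ⟨M, hM⟩ := eventually_atTop.1 hserv
  rcases isEmpty_or_nonempty (Fin n) with hemp | ⟨⟨i₀⟩⟩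
  · rw [show x = fun _ => y from funext fun _ => Subsingleton.elim _ _]
    exact tendsto_const_nhds
  have hσ1 : ε * σ ≤ 1 := by
    have h1 := (htot 0).trans (P.total_le_weight (hx.mem 0).1 (hx.mem 0).2)
    have h2 := mul_pos (P.lam_pos i₀) (P.load_pos i₀)
    exact (mul_le_mul_of_nonneg_left (by linarith) hε.le).trans (hε' i₀)
  set a := fun m => ∑ i, |(x (m + M)).2 i - y.2 i| with ha
  have ha0 : ∀ m, 0 ≤ a m := fun m => Finset.sum_nonneg fun i _ => abs_nonneg _
  have hgeom : ∀ m, a m ≤ (1 - ε * σ) ^ m * a 0 := fun m =>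
    le_geom (by linarith) m fun m _ => by
      have h1 := hx.sum_abs_sub_le hε hε' hy hyf hys (hM (m + M) (by omega))
      rw [add_right_comm] at h1
      refine h1.trans (mul_le_mul_of_nonneg_right ?_ (ha0 m))
      linarith [mul_le_mul_of_nonneg_left (htot (m + M)) hε.le]
  have hlim : Tendsto a atTop (𝓝 0) := by
    refine squeeze_zero ha0 hgeom ?_
    have hpos := mul_pos hε hσ
    simpa using (tendsto_pow_atTop_nhds_zero_of_lt_one (r := 1 - ε * σ) (by linarith)
      (by linarith)).mul_const (a 0)
  refine Tendsto.prodMk_nhds (mx := fun k => (x k).1) (my := fun k => (x k).2) ?_ ?_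
  · rw [hys]
    exact tendsto_nhds_of_eventually_eq hserv
  · rw [← tendsto_add_atTop_iff_nat M, tendsto_pi_nhds]
    intro i
    rw [tendsto_iff_dist_tendsto_zero]
    refine squeeze_zero (fun _ => dist_nonneg) (fun m => ?_) hlim
    rw [Real.dist_eq]
    exact Finset.single_le_sum (f := fun i => |(x (m + M)).2 i - y.2 i|)
      (fun _ _ => abs_nonneg _) (Finset.mem_univ i)

/-- One step bounds the new sum by the convex combination `(1 - ε S) ∑ uᵢ + ε S`. Truncation at `0`
does no harm because each summand of the bound is nonnegative. -/
theorem IsTrajectory.isFeasible {ε : ℝ} (hε : 0 < ε) (hε' : ε * P.weight ≤ 1)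
    {x : ℕ → (Fin n → ℝ) × (Fin n → ℝ)} (hx : P.IsTrajectory ε x) (hf : P.IsFeasible (x 0))
    (k : ℕ) : P.IsFeasible (x k) := by
  induction k with
  | zero => exact hf
  | succ k ih =>
    obtain ⟨hs, hu⟩ := hx.mem k
    rw [P.isFeasible_iff hu] at ih
    rw [P.isFeasible_iff (hx.mem (k + 1)).2]
    set S := P.total (x k).1 (x k).2 with hS
    have hS1 : ε * S ≤ 1 :=
      (mul_le_mul_of_nonneg_left (P.total_le_weight hs hu) hε.le).trans hε'
    have hstep : ∀ i, (x (k + 1)).2 i ≤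
        (1 - ε * S) * (x k).2 i + ε * (P.lam i * P.slack i (x k).1 (x k).2) := fun i => by
      rw [hx.step_platform, Phi_unnorm, ← hS]
      refine max_le ?_ ((min_le_right _ _).trans (by linarith))
      have h1 := mul_nonneg (sub_nonneg.2 hS1) (hu i).1
      have h2 := mul_nonneg hε.le (mul_nonneg (P.lam_pos i).le (P.slack_nonneg i (x k).1 (x k).2))
      linarith
    calc _ ≤ ∑ i, ((1 - ε * S) * (x k).2 i + ε * (P.lam i * P.slack i (x k).1 (x k).2)) :=
          Finset.sum_le_sum fun i _ => hstep i
      _ = (1 - ε * S) * ∑ i, (x k).2 i + ε * S := by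
          rw [Finset.sum_add_distrib, ← Finset.mul_sum, ← Finset.mul_sum, hS, total]
      _ ≤ 1 := by nlinarith

theorem IsTrajectory.eventually_platform_le {ε : ℝ} (hε : 0 < ε) (hε' : ε * P.weight ≤ 1)
    {x : ℕ → (Fin n → ℝ) × (Fin n → ℝ)} (hx : P.IsTrajectory ε x) {σ : ℝ} (hσ : 0 < σ)
    (htot : ∀ k, σ ≤ P.total (x k).1 (x k).2) :
    ∀ᶠ k in atTop, ∀ i, (x k).2 i ≤ 2 / σ := by
  refine eventually_all.2 fun i => ?_
  have hσ1 : ε * σ ≤ 1 := (mul_le_mul_of_nonneg_left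
    ((htot 0).trans (P.total_le_weight (hx.mem 0).1 (hx.mem 0).2)) hε.le).trans hε'
  -- From `Φᵢ ≤ 1 - σ uᵢ`, the excess over the equilibrium `1 / σ` decays geometrically; the final
  -- bound `2 / σ` leaves room to reach it in finite time.
  have hdecr : ∀ k, (x k).2 i - 1 / σ ≤ (1 - ε * σ) ^ k * (max 0 ((x 0).2 i - 1 / σ)) := by
    intro k
    induction k with
    | zero => simp
    | succ k ih =>
      obtain ⟨hs, hu⟩ := hx.mem k
      have h0 : 0 ≤ (1 - ε * σ) ^ (k + 1) * (max 0 ((x 0).2 i - 1 / σ)) :=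
        mul_nonneg (pow_nonneg (by linarith) _) (le_max_left _ _)
      have hpos : 0 < 1 / σ := by positivity
      have hσσ : ε * σ * (1 / σ) = ε := by field_simp
      rw [hx.step_platform, sub_le_iff_le_add]
      refine max_le (by linarith) ((min_le_right _ _).trans ?_)
      have h1 : P.lam i * P.slack i (x k).1 (x k).2 ≤ 1 :=
        mul_le_one₀ (P.lam_le_one i) (P.slack_nonneg i _ _) (P.slack_le_one (hs i) (hu i).1)
      have h2 := mul_le_mul_of_nonneg_left (htot k) (hu i).1
      have h3 : P.Phi i (x k).1 (P.unnorm (x k).2) ≤ 1 - (x k).2 i * σ := by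
        rw [Phi_unnorm]; linarith
      have h4 := mul_le_mul_of_nonneg_left h3 hε.le
      have h5 := mul_le_mul_of_nonneg_left ih (sub_nonneg.2 hσ1)
      rw [pow_succ']
      linarith
  have hlim : Tendsto (fun k => (1 - ε * σ) ^ k * (max 0 ((x 0).2 i - 1 / σ))) atTop (𝓝 0) := by
    have hpos := mul_pos hε hσ
    simpa using (tendsto_pow_atTop_nhds_zero_of_lt_one (r := 1 - ε * σ) (by linarith)
      (by linarith)).mul_const (max 0 ((x 0).2 i - 1 / σ))
  filter_upwards [hlim.eventually_lt_const (show 0 < 1 / σ by positivity)] with k hk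
  have : 2 / σ = 1 / σ + 1 / σ := by ring
  linarith [hdecr k]

theorem exists_step_bound (P : AppSystem n) : ∃ ε₀ : ℝ, 0 < ε₀ ∧ ∀ ε : ℝ, 0 < ε → ε < ε₀ →
    ε * P.weight ≤ 1 ∧ ∀ i, ε * (P.weight + P.lam i * P.load i) ≤ 1 := by
  have hterm : ∀ i, 0 < P.lam i * P.load i := fun i => mul_pos (P.lam_pos i) (P.load_pos i)
  have hsum : 0 ≤ ∑ i, P.lam i * P.load i := Finset.sum_nonneg fun i _ => (hterm i).le
  have hW := P.weight_nonneg
  have hpos : 0 < P.weight + ∑ i, P.lam i * P.load i + 1 := by linarith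
  refine ⟨1 / (P.weight + ∑ i, P.lam i * P.load i + 1), by positivity, fun ε hε hlt => ?_⟩
  have h1 := ((lt_div_iff₀ hpos).1 hlt).le
  refine ⟨(mul_le_mul_of_nonneg_left (by linarith) hε.le).trans h1, fun i => ?_⟩
  refine (mul_le_mul_of_nonneg_left ?_ hε.le).trans h1
  linarith [Finset.single_le_sum (f := fun i => P.lam i * P.load i) (fun j _ => (hterm j).le)
    (Finset.mem_univ i)]

theorem le_one_of_mem_platformSet {u : Fin n → ℝ} (hu : u ∈ P.platformSet) (i : Fin n) :
    u i ≤ 1 := by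
  refine (hu i).2.trans ?_
  rw [div_le_one P.κ_cast_pos]
  exact_mod_cast P.κ_pos

/-! ### Small loads -/

theorem phi_le_of_load_le {s u : Fin n → ℝ} (hs : s ∈ P.serviceSet) (hu : u ∈ P.platformSet)
    {η : ℝ} {i : Fin n} (hη : P.load i ≤ η) : P.phi i (s i) (P.κ * u i) ≤ η - 1 := by
  have h1 := P.phi_le i (hs i) (hu i).1
  have h2 := mul_le_of_le_one_right (P.load_pos i).le (le_one_of_mem_platformSet hu i)
  linarith

theorem sum_lam_mul_load_le {u : Fin n → ℝ} (hu : u ∈ P.platformSet) {η : ℝ}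
    (hη : ∀ i, P.load i ≤ η) : ∑ j, P.lam j * (P.load j * u j) ≤ η * P.weight := by
  rw [weight, Finset.mul_sum]
  refine Finset.sum_le_sum fun j _ => ?_
  rw [mul_comm η]
  refine mul_le_mul_of_nonneg_left ?_ (P.lam_pos j).le
  exact (mul_le_of_le_one_right (P.load_pos j).le (le_one_of_mem_platformSet hu j)).trans (hη j)

theorem IsStationary.near_target_of_small_load {δ : ℝ} (hδ : 0 < δ)
    (hload : ∀ i, P.load i < min (1 / 2) (δ / 4)) {x : (Fin n → ℝ) × (Fin n → ℝ)}
    (hx : P.IsStationary x) (i : Fin n) : x.1 i = P.smin i ∧ |x.2 i - P.target i| < δ := by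
  set η := min (1 / 2) (δ / 4) with hηdef
  have hη : η ≤ 1 / 2 := min_le_left _ _
  have hη' : η ≤ δ / 4 := min_le_right _ _
  have hηpos : 0 < η := (P.load_pos i).trans (hload i)
  have hneg : ∀ j, P.phi j (x.1 j) (P.κ * x.2 j) < 0 := fun j =>
    (phi_le_of_load_le hx.1 hx.2.1 (hload j).le).trans_lt (by linarith)
  refine ⟨((hx.isBalancedOrCapped hneg) i).1, ?_⟩
  have hW : 0 < P.weight := (P.lam_pos i).trans_le (P.lam_le_weight i)
  have hlt : η * P.weight < P.weight := by nlinarith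
  have hi : P.lam i * P.load i ≤ η * P.weight := by
    rw [mul_comm]
    exact mul_le_mul (hload i).le (P.lam_le_weight i) (P.lam_pos i).le hηpos.le
  refine (hx.abs_sub_target_le hneg hlt (sum_lam_mul_load_le hx.2.1 fun j => (hload j).le)
    hi).trans_lt ?_
  have h1 : P.lam i / P.weight ≤ 1 := (div_le_one hW).2 (P.lam_le_weight i)
  have h2 : P.weight - η * P.weight = (1 - η) * P.weight := by ring
  rw [h2, mul_div_mul_right _ _ hW.ne']
  -- `η ≤ 1/2` gives `η / (1 - η) ≤ 2 η`, and `2 η ≤ δ / 2`.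
  have h3 : η / (1 - η) < δ := by
    rw [div_lt_iff₀ (by linarith)]; nlinarith
  exact (mul_le_of_le_one_left (div_nonneg hηpos.le (by linarith)) h1).trans_lt h3

theorem exists_unique_attracting_of_small_load (hload : ∀ i, P.load i < 1 / 2) :
    ∃ xstar, P.IsStationary xstar ∧ P.IsFeasible xstar ∧
      (∀ y, P.IsStationary y → y = xstar) ∧
      ∃ ε₀ : ℝ, 0 < ε₀ ∧ ∀ ε : ℝ, 0 < ε → ε < ε₀ →
        ∀ x, P.IsTrajectory ε x → Tendsto x atTop (𝓝 xstar) := by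
  obtain ⟨y, hy, hyf⟩ := P.exists_isStationary_isFeasible
  obtain ⟨ε₀, hε₀, hstep⟩ := P.exists_step_bound
  have hphi : ∀ {s u : Fin n → ℝ}, s ∈ P.serviceSet → u ∈ P.platformSet → ∀ i,
      P.phi i (s i) (P.κ * u i) ≤ -(1 / 2) := fun hs hu i =>
    (phi_le_of_load_le hs hu (hload i).le).trans (by norm_num)
  have hys : y.1 = P.smin := funext fun i =>
    (hy.isBalancedOrCapped (fun i => (hphi hy.1 hy.2.1 i).trans_lt (by norm_num)) i).1
  have hconv : ∀ ε : ℝ, 0 < ε → ε < ε₀ → ∀ x, P.IsTrajectory ε x → Tendsto x atTop (𝓝 y) := by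
    intro ε hε hlt x hx
    rcases isEmpty_or_nonempty (Fin n) with hemp | ⟨⟨i₀⟩⟩
    · rw [show x = fun _ => y from funext fun _ => Subsingleton.elim _ _]
      exact tendsto_const_nhds
    have hW : 0 < P.weight := (P.lam_pos i₀).trans_le (P.lam_le_weight i₀)
    refine hx.tendsto hε (hstep ε hε hlt).2 hy hyf hys (c := 1 / 2) (σ := P.weight / 2) (K := 0)
      (by norm_num) (by linarith) (fun k _ i => hphi (hx.mem k).1 (hx.mem k).2 i) fun k => ?_
    have h1 := P.weight_sub_le_total (hx.mem k).1 (hx.mem k).2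
    have h2 := sum_lam_mul_load_le (hx.mem k).2 fun j => (hload j).le
    linarith
  refine ⟨y, hy, hyf, fun z hz => ?_, ε₀, hε₀, hconv⟩
  -- A second stationary point is a constant trajectory converging to `y`, hence equal to `y`.
  exact tendsto_const_nhds_iff.1
    (hconv (ε₀ / 2) (by linarith) (by linarith) _ (hz.isTrajectory_const (by linarith)))

/-! ### Many applications -/

theorem weight_sub_le_total_of_isFeasible {x : (Fin n → ℝ) × (Fin n → ℝ)}
    (hs : x.1 ∈ P.serviceSet) (hu : x.2 ∈ P.platformSet) (hf : P.IsFeasible x) {B : ℝ}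
    (hB : 0 ≤ B) (hload : ∀ i, P.load i ≤ B) :
    ∑ j, P.lam j * (P.load j * x.2 j) ≤ B ∧ P.weight - B ≤ P.total x.1 x.2 := by
  have hsum : ∑ j, P.lam j * (P.load j * x.2 j) ≤ B := calc
    _ ≤ ∑ j, B * x.2 j := Finset.sum_le_sum fun j _ =>
        (mul_le_of_le_one_left (mul_nonneg (P.load_pos j).le (hu j).1) (P.lam_le_one j)).trans
          (mul_le_mul_of_nonneg_right (hload j) (hu j).1)
    _ ≤ B := by
        rw [← Finset.mul_sum]
        exact mul_le_of_le_one_right hB ((P.isFeasible_iff hu).1 hf)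
  exact ⟨hsum, by linarith [P.weight_sub_le_total hs hu]⟩

/-- `Φᵢ ≥ 0` gives `uᵢ S ≤ λᵢ σᵢ ≤ 1`, while `S ≥ weight - B > B`; hence `load i * uᵢ < 1`. -/
theorem IsStationary.phi_neg_of_isFeasible {x : (Fin n → ℝ) × (Fin n → ℝ)}
    (hx : P.IsStationary x) (hf : P.IsFeasible x) {B : ℝ} (hB : 0 ≤ B)
    (hload : ∀ i, P.load i ≤ B) (hW : 2 * B < P.weight) (i : Fin n) :
    P.phi i (x.1 i) (P.κ * x.2 i) < 0 := by
  have hT := (weight_sub_le_total_of_isFeasible hx.1 hx.2.1 hf hB hload).2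
  have hPhi := hx.Phi_nonneg i
  rw [Phi_unnorm] at hPhi
  have hxi := (hx.2.1 i).1
  have h1 : P.lam i * P.slack i x.1 x.2 ≤ 1 :=
    mul_le_one₀ (P.lam_le_one i) (P.slack_nonneg i _ _) (P.slack_le_one (hx.1 i) hxi)
  have h2 := P.phi_le i (hx.1 i) hxi
  rcases hxi.eq_or_lt with h | h
  · rw [← h] at h2 ⊢; linarith
  · have h3 : x.2 i * B < x.2 i * P.total x.1 x.2 := mul_lt_mul_of_pos_left (by linarith) h
    have h4 := mul_le_mul_of_nonneg_right (hload i) hxi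
    linarith

theorem nat_mul_le_weight {lam₀ : ℝ} (h : ∀ i, lam₀ ≤ P.lam i) : n * lam₀ ≤ P.weight := by
  simpa [weight] using Finset.card_nsmul_le_sum Finset.univ P.lam lam₀ fun i _ => h i

theorem IsStationary.near_target_of_large_weight {δ B : ℝ} (hδ : 0 < δ) (hB : 0 < B)
    (hload : ∀ i, P.load i ≤ B) (hW : 2 * B < P.weight) (hW' : B / δ + B < P.weight)
    (hκ : (P.κ : ℝ) ≤ P.weight) {x : (Fin n → ℝ) × (Fin n → ℝ)}
    (hx : P.IsStationary x) (hf : P.IsFeasible x) (i : Fin n) :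
    x.1 i = P.smin i ∧ |x.2 i - P.target i| < δ * P.target i := by
  have hneg := hx.phi_neg_of_isFeasible hf hB.le hload hW
  refine ⟨(hx.isBalancedOrCapped hneg i).1, ?_⟩
  have hlam := P.lam_pos i
  have hWpos : 0 < P.weight := by linarith
  -- Once `κ ≤ weight` the cap in the target is inactive, so the error is relative to `target i`
  -- itself.
  have htarget : P.target i = P.lam i / P.weight := by
    refine min_eq_right ?_
    change P.lam i / P.weight ≤ _
    have := P.κ_cast_pos
    have := P.lam_le_one i
    gcongr
  refine (hx.abs_sub_target_le hneg (by linarith)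
    (weight_sub_le_total_of_isFeasible hx.1 hx.2.1 hf hB.le hload).1
    ((mul_le_of_le_one_left (P.load_pos i).le (P.lam_le_one i)).trans (hload i))).trans_lt ?_
  rw [htarget, mul_comm δ]
  refine mul_lt_mul_of_pos_left ?_ (div_pos hlam hWpos)
  rw [div_lt_iff₀ (by linarith), mul_comm, ← div_lt_iff₀ hδ]
  linarith

theorem exists_unique_attracting_of_large_weight {B : ℝ} (hB : 0 < B)
    (hload : ∀ i, P.load i ≤ B) (hW : 5 * B ≤ P.weight) :
    ∃ xstar, P.IsStationary xstar ∧ P.IsFeasible xstar ∧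
      (∀ y, P.IsStationary y → P.IsFeasible y → y = xstar) ∧
      ∃ ε₀ : ℝ, 0 < ε₀ ∧ ∀ ε : ℝ, 0 < ε → ε < ε₀ →
        ∀ x, P.IsTrajectory ε x → P.IsFeasible (x 0) → Tendsto x atTop (𝓝 xstar) := by
  obtain ⟨y, hy, hyf⟩ := P.exists_isStationary_isFeasible
  obtain ⟨ε₀, hε₀, hstep⟩ := P.exists_step_bound
  have hys : y.1 = P.smin := funext fun i =>
    (hy.isBalancedOrCapped (hy.phi_neg_of_isFeasible hyf hB.le hload (by linarith)) i).1
  have hσ : 0 < P.weight - B := by linarith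
  have hconv : ∀ ε : ℝ, 0 < ε → ε < ε₀ → ∀ x, P.IsTrajectory ε x → P.IsFeasible (x 0) →
      Tendsto x atTop (𝓝 y) := by
    intro ε hε hlt x hx hf
    obtain ⟨hεW, hεi⟩ := hstep ε hε hlt
    have htot : ∀ k, P.weight - B ≤ P.total (x k).1 (x k).2 := fun k =>
      (weight_sub_le_total_of_isFeasible (hx.mem k).1 (hx.mem k).2 (hx.isFeasible hε hεW hf k)
        hB.le hload).2
    obtain ⟨K, hK⟩ := eventually_atTop.1 (hx.eventually_platform_le hε hεW hσ htot)
    refine hx.tendsto hε hεi hy hyf hys (c := 1 / 2) (K := K) (by norm_num) hσ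
      (fun k hk i => ?_) htot
    have h1 := P.phi_le i ((hx.mem k).1 i) ((hx.mem k).2 i).1
    have h2 := mul_le_mul (hload i) (hK k hk i) ((hx.mem k).2 i).1 hB.le
    -- This is where `5 * B ≤ weight` is needed: it is equivalent to `4 B ≤ weight - B`.
    have h3 : B * (2 / (P.weight - B)) ≤ 1 / 2 := by
      rw [mul_div_assoc', div_le_iff₀ hσ]; linarith
    linarith
  refine ⟨y, hy, hyf, fun z hz hzf => ?_, ε₀, hε₀, hconv⟩
  exact tendsto_const_nhds_iff.1
    (hconv (ε₀ / 2) (by linarith) (by linarith) _ (hz.isTrajectory_const (by linarith)) hzf)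

theorem exists_nat_forall_le_weight {lam₀ : ℝ} (h₀ : 0 < lam₀) (M : ℝ) :
    ∃ N : ℕ, ∀ n : ℕ, N ≤ n → ∀ P : AppSystem n, (∀ i, lam₀ ≤ P.lam i) → M ≤ P.weight := by
  obtain ⟨N, hN⟩ := exists_nat_ge (M / lam₀)
  refine ⟨N, fun n hn P hP => ?_⟩
  have h1 : (N : ℝ) ≤ n := by exact_mod_cast hn
  exact ((div_le_iff₀ h₀).1 (hN.trans h1)).trans (nat_mul_le_weight hP)

end AppSystem

/-! ### Assembly with explicit thresholds -/

theorem theorem1 :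
    -- Part 1, under (H1) or (H2).
    (∀ (n : ℕ) (P : AppSystem n), P.HighDemand →
      (∃ x, P.IsStationary x ∧ P.IsFeasible x) ∧
      (∀ x, P.IsStationary x → P.IsBalancedOrCapped x)) ∧
    (∀ (n : ℕ) (P : AppSystem n), P.ManyApplications →
      (∃ x, P.IsStationary x ∧ P.IsFeasible x) ∧
      (∀ x, P.IsStationary x → P.IsFeasible x → P.IsBalancedOrCapped x)) ∧
    -- Part 2 (i), as `βᵢ κ / sminᵢ → 0` for all `i`, with `n`, `κ` and the weights fixed.
    (∀ (n κ : ℕ) (lam : Fin n → ℝ),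
      (∀ δ : ℝ, 0 < δ → ∃ η : ℝ, 0 < η ∧ ∀ P : AppSystem n, P.κ = κ → P.lam = lam →
        (∀ i, P.β i * P.κ / P.smin i < η) →
        ∀ x, P.IsStationary x → ∀ i, x.1 i = P.smin i ∧ |x.2 i - P.target i| < δ) ∧
      (∃ η : ℝ, 0 < η ∧ ∀ P : AppSystem n, P.κ = κ → P.lam = lam →
        (∀ i, P.β i * P.κ / P.smin i < η) →
        ∃ xstar, P.IsStationary xstar ∧ P.IsFeasible xstar ∧
          (∀ y, P.IsStationary y → y = xstar) ∧
          ∃ ε₀ : ℝ, 0 < ε₀ ∧ ∀ ε : ℝ, 0 < ε → ε < ε₀ →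
            ∀ x, P.IsTrajectory ε x → Tendsto x atTop (𝓝 xstar))) ∧
    -- Part 2 (ii), as `n → ∞`, with `κ`, an upper bound on `βᵢ κ / sminᵢ` and a positive lower
    -- bound on the weights fixed.
    (∀ (κ : ℕ) (lam₀ B : ℝ), 0 < lam₀ →
      (∀ δ : ℝ, 0 < δ → ∃ N : ℕ, ∀ n : ℕ, N ≤ n → ∀ P : AppSystem n, P.κ = κ →
        (∀ i, lam₀ ≤ P.lam i) → (∀ i, P.β i * P.κ / P.smin i ≤ B) →
        ∀ x, P.IsStationary x → P.IsFeasible x →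
          ∀ i, x.1 i = P.smin i ∧ |x.2 i - P.target i| < δ * P.target i) ∧
      (∃ N : ℕ, ∀ n : ℕ, N ≤ n → ∀ P : AppSystem n, P.κ = κ →
        (∀ i, lam₀ ≤ P.lam i) → (∀ i, P.β i * P.κ / P.smin i ≤ B) →
        ∃ xstar, P.IsStationary xstar ∧ P.IsFeasible xstar ∧
          (∀ y, P.IsStationary y → P.IsFeasible y → y = xstar) ∧
          ∃ ε₀ : ℝ, 0 < ε₀ ∧ ∀ ε : ℝ, 0 < ε → ε < ε₀ →
            ∀ x, P.IsTrajectory ε x → P.IsFeasible (x 0) →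
              Tendsto x atTop (𝓝 xstar))) := by
  refine ⟨fun n P hP => ⟨P.exists_isStationary_isFeasible, fun x hx =>
      AppSystem.isBalancedOrCapped_of_highDemand hP hx⟩,
    fun n P hP => ⟨P.exists_isStationary_isFeasible, fun x hx hf =>
      AppSystem.isBalancedOrCapped_of_manyApplications hP hx hf⟩,
    fun n κ lam => ⟨fun δ hδ => ?_, 1 / 2, by norm_num, fun P _ _ hload =>
      AppSystem.exists_unique_attracting_of_small_load hload⟩,
    fun κ lam₀ B h₀ => ⟨fun δ hδ => ?_, ?_⟩⟩
  · exact ⟨min (1 / 2) (δ / 4), by positivity, fun P _ _ hload x hx i =>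
      hx.near_target_of_small_load hδ hload i⟩
  -- `B` has no prescribed sign, so it is replaced by `max B 1`. The threshold adds up the demands
  -- `2B`, `B / δ + B` and `κ` on the weight, with `+ 1` for strictness.
  · have hB : 0 < max B 1 := by positivity
    have hBδ : 0 < max B 1 / δ := by positivity
    obtain ⟨N, hN⟩ := AppSystem.exists_nat_forall_le_weight h₀
      (2 * max B 1 + max B 1 / δ + κ + 1)
    refine ⟨N, fun n hn P hκ hlam hload x hx hf i => ?_⟩
    have hW := hN n hn P hlam
    have hκ0 : (0 : ℝ) ≤ κ := Nat.cast_nonneg κ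
    exact hx.near_target_of_large_weight hδ hB (fun j => (hload j).trans (le_max_left _ _))
      (by linarith) (by linarith) (by rw [hκ]; linarith) hf i
  · obtain ⟨N, hN⟩ := AppSystem.exists_nat_forall_le_weight h₀ (5 * max B 1)
    exact ⟨N, fun n hn P _ hlam hload =>
      AppSystem.exists_unique_attracting_of_large_weight (by positivity)
        (fun j => (hload j).trans (le_max_left _ _)) (hN n hn P hlam)⟩
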